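/- Let $\mathbb{K}$ be $\mathbb{R}$ or $\mathbb{C}$, and let $0 \le k \le n$ be integers. Let $\mathcal V_{k,n} = \{Z \in \mathbb{K}^{n\times k} : Z^T Z = \mathrm{Id}_k\}$ be the Stiefel variety, a subset of the affine space $\mathbb{A}^{nk}$ over $\mathbb{K}$ (with $Z^T$ the transpose, without complex conjugation), and let $I_{\rm St} = \langle Z^TZ - \mathrm{Id}_k\rangle \subseteq \mathbb{K}[Z]$ be the ideal generated by the entries of $Z^TZ - \mathrm{Id}_k$, where $Z$ is an $n\times k$ matrix of unknowns. For a subset $V$ of affine space, $I(V)$ denotes the ideal of all polynomials over $\mathbb{K}$ that vanish on $V$. Then: 1. The dimension of $\mathcal V_{k,n}$, that is, the Krull dimension of its coordinate ring $\mathbb{K}[Z]/I(\mathcal V_{k,n})$, is $$\dim(\mathcal V_{k,n}) = nk - \binom{k+1}{2} = \binom{n}{2} - \binom{n-k}{2}.$$ 2. $I(\mathcal V_{k,n}) = I_{\rm St}$, and this ideal is a complete intersection, that is, it is a proper ideal which can be generated by as many elements as its codimension (height). 3. If $k < n$, then $\mathcal V_{k,n}$ is irreducible (in the Zariski topology) and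 $I_{\rm St}$ is a prime ideal. -/

import Mathlib

open Matrix

noncomputable section

namespace Stiefel

/-- The Stiefel manifold `V_{k,n}` of orthonormal `k`-frames in `𝕜ⁿ`: the `n × k` matrices `Z` with
`Zᵀ Z = Id_k`, seen as points of the affine space `𝔸^{nk}` with coordinates indexed by the
matrix entries. -/
def variety (𝕜 : Type*) [RCLike 𝕜] (k n : ℕ) : Set (Fin n × Fin k → 𝕜) :=
  {p | (Matrix.of fun i j => p (i, j) : Matrix (Fin n) (Fin k) 𝕜)ᵀ *
      (Matrix.of fun i j => p (i, j) : Matrix (Fin n) (Fin k) 𝕜) = 1}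

/-- The ideal `⟨Zᵀ Z - Id_k⟩` of `𝕜[Z]` generated by the entries of `Zᵀ Z - Id_k`, where `Z` is the
`n × k` matrix of unknowns. -/
def ideal (𝕜 : Type*) [RCLike 𝕜] (k n : ℕ) : Ideal (MvPolynomial (Fin n × Fin k) 𝕜) :=
  Ideal.span (Set.range fun ab : Fin k × Fin k =>
    ((mvPolynomialX (Fin n) (Fin k) 𝕜)ᵀ * mvPolynomialX (Fin n) (Fin k) 𝕜 - 1 :
      Matrix (Fin k) (Fin k) (MvPolynomial (Fin n × Fin k) 𝕜)) ab.1 ab.2)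

end Stiefel

/-- The dimension of a subset `V` of an affine space: the Krull dimension of its coordinate ring
`𝕜[x] / I(V)`. -/
def affineDim {𝕜 σ : Type*} [Field 𝕜] (V : Set (σ → 𝕜)) : WithBot ℕ∞ :=
  ringKrullDim (MvPolynomial σ 𝕜 ⧸ MvPolynomial.vanishingIdeal 𝕜 V)

/-- Irreducibility in the Zariski topology: `V` is non-empty, and whenever two Zariski closed sets
cover `V`, one of them alone contains `V`. -/
def IsZariskiIrreducible {𝕜 σ : Type*} [Field 𝕜] (V : Set (σ → 𝕜)) : Prop :=
  V.Nonempty ∧ ∀ I J : Ideal (MvPolynomial σ 𝕜),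
    V ⊆ MvPolynomial.zeroLocus 𝕜 I ∪ MvPolynomial.zeroLocus 𝕜 J →
      V ⊆ MvPolynomial.zeroLocus 𝕜 I ∨ V ⊆ MvPolynomial.zeroLocus 𝕜 J

/-- A proper ideal is a complete intersection if it can be generated by as many elements as its
codimension (height). -/
def IsCompleteIntersection {R : Type*} [CommRing R] (I : Ideal R) : Prop :=
  I ≠ ⊤ ∧ ∃ (c : ℕ) (f : Fin c → R), Ideal.span (Set.range f) = I ∧ I.height = c

end

/-! Let v = (1, t) be proportional to e₀ plus the first column of Z. The reflection in v sends that
column to -e₀, and orthonormality makes the reflected frame `diag(-1, Y)` with Y a frame having one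
row and one column fewer. So frames with 1 + Z₀₀ invertible correspond to pairs (t, Y) with 1 + t ⬝
t invertible (`exists_eq_param`). This holds over any commutative ring in which 2 is invertible,
hence also for the tautological frame over localizations of 𝕜[Z]/I_St. No Nullstellensatz is needed,
and ℝ and ℂ are treated alike. The substitution Z ↦ -Z gives the second chart, where 1 - Z₀₀ is
invertible.

Induction on k through this chart gives three things. A polynomial vanishing on the variety lies in
I_St after multiplication by a power of 1 + Z₀₀, likewise for 1 - Z₀₀, and these two are coprime
(`vanishingIdeal_variety`). The ideal of affine space times a variety with prime ideal is prime, so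
each chart is irreducible, and for k < n the two charts meet (`vanishingIdeal_isPrime`). Finally, a
frame over a field has entries rational in nk - (k + 1 choose 2) elements, which bounds
transcendence degrees and so bounds the height of I_St below. As Zᵀ Z is symmetric, (k + 1 choose 2)
generators suffice, and Krull's height theorem gives the opposite bound (`height_ideal`); the
dimension follows. -/

noncomputable section
namespace Stiefel

/-! ### Rational parametrization of frames by reflections -/

/-- The matrix `diag(-1, Y)`. -/
def negOneBlock {S : Type*} [CommRing S] {n k : ℕ} (Y : Matrix (Fin n) (Fin k) S) :
    Matrix (Fin (n + 1)) (Fin (k + 1)) S :=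
  Matrix.of (Fin.cons (Fin.cons (-1) 0) fun i => Fin.cons 0 (Y i))

/-- The matrix `1 - 2 e v vᵀ` with `v = (1, t)`, a reflection when `e` is inverse to `v ⬝ v`. -/
def reflection {S : Type*} [CommRing S] {n : ℕ} (t : Fin n → S) (e : S) :
    Matrix (Fin (n + 1)) (Fin (n + 1)) S :=
  1 - (2 * e) • vecMulVec (Fin.cons 1 t : Fin (n + 1) → S) (Fin.cons 1 t : Fin (n + 1) → S)

/-- The rational parametrization of frames by a vector and a smaller frame. -/
def param {S : Type*} [CommRing S] {n k : ℕ} (t : Fin n → S) (e : S)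
    (Y : Matrix (Fin n) (Fin k) S) : Matrix (Fin (n + 1)) (Fin (k + 1)) S :=
  reflection t e * negOneBlock Y

section
variable {S : Type*} [CommRing S] {n k : ℕ}

lemma cons_dotProduct_cons (t : Fin n → S) :
    (Fin.cons 1 t : Fin (n + 1) → S) ⬝ᵥ (Fin.cons 1 t : Fin (n + 1) → S) = 1 + t ⬝ᵥ t := by
  simp [dotProduct, Fin.sum_univ_succ]

lemma reflection_transpose (t : Fin n → S) (e : S) : (reflection t e)ᵀ = reflection t e := by
  simp [reflection, transpose_vecMulVec]

lemma reflection_mul_self (t : Fin n → S) (e : S) (he : e * (1 + t ⬝ᵥ t) = 1) :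
    reflection t e * reflection t e = 1 := by
  simp only [reflection, sub_mul, mul_sub, one_mul, mul_one, smul_mul_smul_comm,
    vecMulVec_mul_vecMulVec, cons_dotProduct_cons, vecMulVec_smul, smul_smul]
  rw [show 2 * e * (2 * e) * (1 + t ⬝ᵥ t) = 2 * e + 2 * e by linear_combination 4 * e * he, add_smul]
  abel

lemma negOneBlock_transpose_mul_self (Y : Matrix (Fin n) (Fin k) S) (hY : Yᵀ * Y = 1) :
    (negOneBlock Y)ᵀ * negOneBlock Y = 1 := by
  ext a b
  have h := fun a b => congr_fun (congr_fun hY a) b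
  simp only [mul_apply, transpose_apply] at h ⊢
  rw [Fin.sum_univ_succ]
  refine Fin.cases ?_ (fun a => ?_) a <;> refine Fin.cases ?_ (fun b => ?_) b <;>
    simp [negOneBlock, one_apply, h, Fin.succ_ne_zero, (Fin.succ_ne_zero _).symm]

lemma param_transpose_mul_self (t : Fin n → S) (e : S) (Y : Matrix (Fin n) (Fin k) S)
    (he : e * (1 + t ⬝ᵥ t) = 1) (hY : Yᵀ * Y = 1) : (param t e Y)ᵀ * param t e Y = 1 := by
  rw [param, transpose_mul, reflection_transpose, Matrix.mul_assoc,
    ← Matrix.mul_assoc (reflection t e),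
    reflection_mul_self t e he, Matrix.one_mul, negOneBlock_transpose_mul_self Y hY]

lemma negOneBlock_map {T : Type*} [CommRing T] (φ : S →+* T) (Y : Matrix (Fin n) (Fin k) S) :
    (negOneBlock Y).map φ = negOneBlock (Y.map φ) := by
  ext a b
  refine Fin.cases ?_ (fun a => ?_) a <;> refine Fin.cases ?_ (fun b => ?_) b <;>
  simp [negOneBlock]

lemma param_map {T : Type*} [CommRing T] (φ : S →+* T) (t : Fin n → S) (e : S)
    (Y : Matrix (Fin n) (Fin k) S) :
    (param t e Y).map φ = param (fun i => φ (t i)) (φ e) (Y.map φ) := by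
  have h2 : (reflection t e).map φ = reflection (fun i => φ (t i)) (φ e) := by
    ext a b
    refine Fin.cases ?_ (fun a => ?_) a <;> refine Fin.cases ?_ (fun b => ?_) b <;>
    simp [reflection, one_apply, vecMulVec_apply, apply_ite φ, map_ofNat]
  rw [param, Matrix.map_mul, negOneBlock_map, h2, param]

/-- A frame whose upper left entry is not `-1` lies in the image of the parametrization. -/
lemma exists_eq_param (Z : Matrix (Fin (n + 1)) (Fin (k + 1)) S) (hZ : Zᵀ * Z = 1) (w h2 : S)
    (hw : w * (1 + Z 0 0) = 1) (hh2 : h2 * 2 = 1) :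
    ∃ (t : Fin n → S) (Y : Matrix (Fin n) (Fin k) S),
      h2 * (1 + Z 0 0) * (1 + t ⬝ᵥ t) = 1 ∧ Yᵀ * Y = 1 ∧ Z = param t (h2 * (1 + Z 0 0)) Y := by
  -- `w` inverts 1 + Z₀₀, so (1, t) is `w` times e₀ plus the first column. As that column has square
  -- sum 1, 1 + t ⬝ t = 2 / (1 + Z₀₀), whose inverse is `e`.
  set t : Fin n → S := fun i => w * Z i.succ 0 with ht
  set e : S := h2 * (1 + Z 0 0) with hedef
  have h00 := congr_fun (congr_fun hZ 0) 0
  simp only [mul_apply, transpose_apply, Fin.sum_univ_succ, one_apply_eq] at h00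
  have htt : t ⬝ᵥ t = w ^ 2 * ∑ i : Fin n, Z i.succ 0 * Z i.succ 0 := by
    rw [dotProduct, Finset.mul_sum]
    exact Finset.sum_congr rfl fun i _ => by simp only [ht]; ring
  have he : e * (1 + t ⬝ᵥ t) = 1 := by
    rw [htt, eq_sub_of_add_eq' h00, hedef]
    linear_combination h2 * (1 - Z 0 0) * (w * (1 + Z 0 0) + 1) * hw + hh2
  have hcol : ∀ i, (reflection t e * Z) i 0 = (Fin.cons (-1) 0 : Fin (n + 1) → S) i := by
    have hv : (Fin.cons 1 t : Fin (n + 1) → S) ⬝ᵥ (fun i => Z i 0) = 1 := by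
      have : (Fin.cons 1 t : Fin (n + 1) → S) ⬝ᵥ (fun i => Z i 0) =
          Z 0 0 + w * ∑ i : Fin n, Z i.succ 0 * Z i.succ 0 := by
        simp [dotProduct, Fin.sum_univ_succ, ht, Finset.mul_sum, mul_assoc]
      rw [this, eq_sub_of_add_eq' h00]
      linear_combination (1 - Z 0 0) * hw
    intro i
    have hi : (reflection t e * Z) i 0 =
        Z i 0 - (2 * e) * (Fin.cons 1 t : Fin (n + 1) → S) i *
          ((Fin.cons 1 t : Fin (n + 1) → S) ⬝ᵥ (fun i => Z i 0)) := by
      rw [reflection, Matrix.sub_mul, Matrix.one_mul, smul_mul, Matrix.sub_apply,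
          Matrix.smul_apply, vecMulVec_mul,
        vecMulVec_apply, smul_eq_mul, ← mul_assoc]
      rfl
    rw [hi, hv, hedef]
    refine Fin.cases ?_ (fun i => ?_) i
    · simp only [Fin.cons_zero]
      linear_combination (-(1 + Z 0 0)) * hh2
    · simp only [Fin.cons_succ, ht, Pi.zero_apply]
      linear_combination (-(1 + Z 0 0) * w * Z i.succ 0) * hh2 - Z i.succ 0 * hw
  set W := reflection t e * Z with hW
  have hWW : Wᵀ * W = 1 := by
    rw [hW, transpose_mul, reflection_transpose, Matrix.mul_assoc,
    ← Matrix.mul_assoc (reflection t e),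
      reflection_mul_self t e he, Matrix.one_mul, hZ]
  -- The first column of `W` is -e₀, so orthogonality to it clears the rest of the top row.
  have hrow : ∀ j : Fin k, W 0 j.succ = 0 := by
    intro j
    have := congr_fun (congr_fun hWW 0) j.succ
    simp only [mul_apply, transpose_apply, Fin.sum_univ_succ, hcol] at this
    simpa [one_apply, (Fin.succ_ne_zero _).symm] using this
  set Y : Matrix (Fin n) (Fin k) S := Matrix.of fun i j => W i.succ j.succ with hY
  have hWY : W = negOneBlock Y := by
    ext a b
    refine Fin.cases ?_ (fun a => ?_) a <;> refine Fin.cases ?_ (fun b => ?_) b <;>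
      simp [negOneBlock, hcol, hrow, hY]
  refine ⟨t, Y, he, ?_, ?_⟩
  · ext a b
    have := congr_fun (congr_fun hWW a.succ) b.succ
    simp only [mul_apply, transpose_apply, Fin.sum_univ_succ, hrow] at this
    simpa [mul_apply, hY, one_apply] using this
  · rw [param, ← hWY, hW, ← Matrix.mul_assoc, reflection_mul_self t e he, Matrix.one_mul]

end
-- Clearing denominators; vanishing on affine space times the frames
section
variable {S : Type*} [CommRing S] {n k : ℕ}

/-- The numerators of the entries of `param t e Y` with respect to the denominator `1 + t ⬝ t`. -/
def paramNum (t : Fin n → S) (Y : Matrix (Fin n) (Fin k) S) :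
    Matrix (Fin (n + 1)) (Fin (k + 1)) S :=
  (1 + t ⬝ᵥ t) • negOneBlock Y - (2 : S) • (vecMulVec (Fin.cons 1 t : Fin (n + 1) → S)
    (Fin.cons 1 t : Fin (n + 1) → S) * negOneBlock Y)

lemma smul_paramNum (t : Fin n → S) (e : S) (Y : Matrix (Fin n) (Fin k) S)
    (he : e * (1 + t ⬝ᵥ t) = 1) : e • paramNum t Y = param t e Y := by
  rw [paramNum, param, reflection, smul_sub, smul_smul, he, one_smul, smul_smul, Matrix.sub_mul,
    Matrix.one_mul, smul_mul, mul_comm e 2]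

lemma paramNum_map {T : Type*} [CommRing T] (φ : S →+* T) (t : Fin n → S)
    (Y : Matrix (Fin n) (Fin k) S) :
    (paramNum t Y).map φ = paramNum (fun i => φ (t i)) (Y.map φ) := by
  have h : (fun i => φ ((Fin.cons 1 t : Fin (n + 1) → S) i)) =
      (Fin.cons 1 fun i => φ (t i) : Fin (n + 1) → T) := by
    ext i
    refine Fin.cases ?_ (fun i => ?_) i <;> simp
  have hB := negOneBlock_map φ Y
  ext a b
  have hab := fun a b => congr_fun (congr_fun hB a) b
  have h' := fun a => congr_fun h a
  simp only [map_apply] at hab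
  simp [paramNum, mul_apply, vecMulVec_apply, hab, h', dotProduct, map_ofNat]
end

variable {K : Type*} [Field K] {n k : ℕ}

/-- Evaluation of a polynomial in `t` with coefficients polynomials in the entries of `Y`. -/
def evalPair {S : Type*} [CommRing S] [Algebra K S] (t : Fin n → S)
    (Y : Matrix (Fin n) (Fin k) S) :
    MvPolynomial (Fin n) (MvPolynomial (Fin n × Fin k) K) →+* S :=
  MvPolynomial.eval₂Hom (MvPolynomial.aeval fun p : Fin n × Fin k => Y p.1 p.2).toRingHom t

/-- The polynomial `1 + t ⬝ t`. -/
def denom (K : Type*) [Field K] (n k : ℕ) :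
    MvPolynomial (Fin n) (MvPolynomial (Fin n × Fin k) K) :=
  1 + MvPolynomial.X ⬝ᵥ MvPolynomial.X

@[simp] lemma evalPair_denom {S : Type*} [CommRing S] [Algebra K S] (t : Fin n → S)
    (Y : Matrix (Fin n) (Fin k) S) : evalPair (K := K) t Y (denom K n k) = 1 + t ⬝ᵥ t := by
  simp [evalPair, denom, dotProduct]

/-- A polynomial pulled back along the parametrization becomes polynomial after clearing
denominators. -/
lemma exists_evalPair_eq (f : MvPolynomial (Fin (n + 1) × Fin (k + 1)) K) :
    ∃ (g : MvPolynomial (Fin n) (MvPolynomial (Fin n × Fin k) K)) (N : ℕ),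
      ∀ {S : Type*} [CommRing S] [Algebra K S] (t : Fin n → S) (e : S)
        (Y : Matrix (Fin n) (Fin k) S), e * (1 + t ⬝ᵥ t) = 1 →
        evalPair t Y g * e ^ N = MvPolynomial.aeval (fun p => param t e Y p.1 p.2) f := by
  induction f using MvPolynomial.induction_on with
  | C a =>
    refine ⟨MvPolynomial.C (MvPolynomial.C a), 0, fun t e Y _ => ?_⟩
    simp [evalPair]
  | add f₁ f₂ h₁ h₂ =>
    obtain ⟨g₁, N₁, h₁⟩ := h₁
    obtain ⟨g₂, N₂, h₂⟩ := h₂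
    refine ⟨g₁ * denom K n k ^ N₂ + g₂ * denom K n k ^ N₁, N₁ + N₂, fun t e Y he => ?_⟩
    have h1 : (e * (1 + t ⬝ᵥ t)) ^ N₁ = 1 := by rw [he, one_pow]
    have h2 : (e * (1 + t ⬝ᵥ t)) ^ N₂ = 1 := by rw [he, one_pow]
    rw [mul_pow] at h1 h2
    rw [map_add, map_add, map_mul, map_mul, map_pow, map_pow, evalPair_denom, ← h₁ t e Y he,
      ← h₂ t e Y he]
    linear_combination evalPair t Y g₁ * e ^ N₁ * h2 + evalPair t Y g₂ * e ^ N₂ * h1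
  | mul_X f p h =>
    obtain ⟨g, N, h⟩ := h
    refine ⟨g * paramNum MvPolynomial.X (Matrix.of fun i j => MvPolynomial.C (MvPolynomial.X (i, j)) :
      Matrix (Fin n) (Fin k) (MvPolynomial (Fin n) (MvPolynomial (Fin n × Fin k) K))) p.1 p.2,
      N + 1, fun t e Y he => ?_⟩
    have := congr_fun (congr_fun (paramNum_map (evalPair (K := K) t Y) MvPolynomial.X
      (Matrix.of fun i j => MvPolynomial.C (MvPolynomial.X (i, j)))) p.1) p.2
    have hp := congr_fun (congr_fun (smul_paramNum t e Y he) p.1) p.2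
    rw [map_mul, map_mul, ← h t e Y he, MvPolynomial.aeval_X, ← hp]
    rw [map_apply] at this
    rw [this]
    have hY : (Matrix.of fun i j => MvPolynomial.C (MvPolynomial.X (i, j)) :
        Matrix (Fin n) (Fin k) (MvPolynomial (Fin n) (MvPolynomial (Fin n × Fin k) K))).map
          (evalPair (K := K) t Y) = Y := by
      ext a b
      simp [evalPair]
    have ht : (fun i => evalPair (K := K) t Y (MvPolynomial.X i)) = t := by
      ext a
      simp [evalPair]
    rw [hY, ht, Matrix.smul_apply, smul_eq_mul]
    ring

lemma mem_variety_iff {𝕜 : Type*} [RCLike 𝕜] {k n : ℕ} (p : Fin n × Fin k → 𝕜) :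
    p ∈ variety 𝕜 k n ↔
      (Matrix.of fun i j => p (i, j))ᵀ * (Matrix.of fun i j => p (i, j)) = 1 := Iff.rfl

/-- The ideal of the frames extends to the ideal of the product of an affine space with the
variety of frames. -/
lemma mem_map_C_vanishingIdeal_iff {𝕜 : Type*} [RCLike 𝕜] {k n : ℕ}
    (g : MvPolynomial (Fin n) (MvPolynomial (Fin n × Fin k) 𝕜)) :
    g ∈ (MvPolynomial.vanishingIdeal 𝕜 (variety 𝕜 k n)).map MvPolynomial.C ↔
      ∀ (t : Fin n → 𝕜) (Y : Matrix (Fin n) (Fin k) 𝕜), Yᵀ * Y = 1 → evalPair t Y g = 0 := by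
  have key (t : Fin n → 𝕜) (Y : Matrix (Fin n) (Fin k) 𝕜) : evalPair t Y g =
      MvPolynomial.eval t (MvPolynomial.map (MvPolynomial.aeval
        fun p : Fin n × Fin k => Y p.1 p.2).toRingHom g) := by
    rw [evalPair, MvPolynomial.eval_map]; rfl
  rw [MvPolynomial.mem_map_C_iff]
  constructor
  · intro h t Y hY
    rw [key]
    convert map_zero (MvPolynomial.eval t)
    ext m
    rw [MvPolynomial.coeff_map, MvPolynomial.coeff_zero]
    exact h m (fun p => Y p.1 p.2) hY
  · intro h m p hp
    -- For a fixed frame, a polynomial in t that vanishes at every point over an infinite field has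
    -- zero coefficients.
    have : MvPolynomial.map (MvPolynomial.aeval (R := 𝕜) p).toRingHom g = 0 :=
      MvPolynomial.funext fun t => by
        have := h t (Matrix.of fun i j => p (i, j)) hp
        rw [key] at this
        simpa using this
    have := congr_arg (MvPolynomial.coeff m) this
    rwa [MvPolynomial.coeff_map, MvPolynomial.coeff_zero] at this

/-! ### The Stiefel ideal is the vanishing ideal -/

section
universe u
variable {𝕜 : Type u} [RCLike 𝕜] {k n : ℕ}

/-- The polynomials of the Stiefel ideal vanish at orthonormal frames over any algebra. -/
lemma aeval_eq_zero_of_mem_ideal {S : Type*} [CommRing S] [Algebra 𝕜 S]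
    (Z : Matrix (Fin n) (Fin k) S) (hZ : Zᵀ * Z = 1) {f : MvPolynomial (Fin n × Fin k) 𝕜}
    (hf : f ∈ ideal 𝕜 k n) : MvPolynomial.aeval (fun p : Fin n × Fin k => Z p.1 p.2) f = 0 := by
  suffices h : ideal 𝕜 k n ≤
      RingHom.ker (MvPolynomial.aeval (R := 𝕜) fun p : Fin n × Fin k => Z p.1 p.2) from h hf
  rw [ideal, Ideal.span_le]
  rintro _ ⟨⟨a, b⟩, rfl⟩
  have := congr_fun (congr_fun hZ a) b
  simp only [mul_apply, transpose_apply] at this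
  simp only [SetLike.mem_coe, RingHom.mem_ker, Matrix.sub_apply, mul_apply, transpose_apply,
    map_sub, map_sum, map_mul, mvPolynomialX_apply, MvPolynomial.aeval_X, this]
  by_cases h : a = b <;> simp [h, one_apply]

/-- The tautological frame over the quotient by the Stiefel ideal. -/
lemma mk_transpose_mul_self :
    ((mvPolynomialX (Fin n) (Fin k) 𝕜).map (Ideal.Quotient.mk (ideal 𝕜 k n)))ᵀ *
      (mvPolynomialX (Fin n) (Fin k) 𝕜).map (Ideal.Quotient.mk (ideal 𝕜 k n)) = 1 := by
  ext a b
  have h : ((mvPolynomialX (Fin n) (Fin k) 𝕜)ᵀ * mvPolynomialX (Fin n) (Fin k) 𝕜 - 1 :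
      Matrix (Fin k) (Fin k) (MvPolynomial (Fin n × Fin k) 𝕜)) a b ∈ ideal 𝕜 k n := Ideal.subset_span ⟨(a, b), rfl⟩
  rw [← Ideal.Quotient.eq_zero_iff_mem, Matrix.sub_apply, map_sub, sub_eq_zero] at h
  simp only [mul_apply, transpose_apply, map_sum, map_mul] at h
  simp only [mul_apply, transpose_apply, map_apply, h]
  by_cases h : a = b <;> simp [h, one_apply]

lemma ideal_le_vanishingIdeal :
    ideal 𝕜 k n ≤ MvPolynomial.vanishingIdeal 𝕜 (variety 𝕜 k n) := fun _ hf p hp =>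
  aeval_eq_zero_of_mem_ideal (Matrix.of fun i j => p (i, j)) hp hf

lemma neg_transpose_mul_self {S : Type*} [CommRing S] {Z : Matrix (Fin n) (Fin k) S}
    (hZ : Zᵀ * Z = 1) : (-Z)ᵀ * (-Z) = 1 := by
  rw [transpose_neg, Matrix.neg_mul, Matrix.mul_neg, neg_neg, hZ]

lemma neg_mem_variety {p : Fin n × Fin k → 𝕜} (hp : p ∈ variety 𝕜 k n) : -p ∈ variety 𝕜 k n :=
  neg_transpose_mul_self (Z := Matrix.of fun i j => p (i, j)) hp

/-- The substitution `Z ↦ -Z`. -/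
def negHom (𝕜 : Type*) [RCLike 𝕜] (k n : ℕ) :
    MvPolynomial (Fin n × Fin k) 𝕜 →ₐ[𝕜] MvPolynomial (Fin n × Fin k) 𝕜 :=
  MvPolynomial.aeval fun p => -MvPolynomial.X p

lemma negHom_negHom (f : MvPolynomial (Fin n × Fin k) 𝕜) : negHom 𝕜 k n (negHom 𝕜 k n f) = f := by
  suffices h : (negHom 𝕜 k n).comp (negHom 𝕜 k n) = AlgHom.id _ _ from DFunLike.congr_fun h f
  ext p
  simp [negHom]

lemma aeval_negHom (p : Fin n × Fin k → 𝕜) (f : MvPolynomial (Fin n × Fin k) 𝕜) :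
    MvPolynomial.aeval p (negHom 𝕜 k n f) = MvPolynomial.aeval (-p) f := by
  suffices h : (MvPolynomial.aeval p).comp (negHom 𝕜 k n) = MvPolynomial.aeval (R := 𝕜) (-p) from
    DFunLike.congr_fun h f
  ext p
  simp [negHom]

lemma negHom_mem_vanishingIdeal {f : MvPolynomial (Fin n × Fin k) 𝕜}
    (hf : f ∈ MvPolynomial.vanishingIdeal 𝕜 (variety 𝕜 k n)) :
    negHom 𝕜 k n f ∈ MvPolynomial.vanishingIdeal 𝕜 (variety 𝕜 k n) := fun p hp => by
  rw [aeval_negHom]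
  exact hf _ (neg_mem_variety hp)

lemma negHom_mem_ideal {f : MvPolynomial (Fin n × Fin k) 𝕜} (hf : f ∈ ideal 𝕜 k n) :
    negHom 𝕜 k n f ∈ ideal 𝕜 k n := by
  rw [← Ideal.Quotient.eq_zero_iff_mem]
  rw [← aeval_eq_zero_of_mem_ideal _ (neg_transpose_mul_self mk_transpose_mul_self) hf]
  suffices h : (Ideal.Quotient.mkₐ 𝕜 (ideal 𝕜 k n)).comp (negHom 𝕜 k n) = MvPolynomial.aeval _ from
    DFunLike.congr_fun h f
  ext p
  simp [negHom]

/-- Pulling back along the parametrization decides vanishing on frames with `1 + Z₀₀ ≠ 0`. -/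
lemma evalPair_mul_denom_eq_zero {f : MvPolynomial (Fin (n + 1) × Fin (k + 1)) 𝕜}
    (hf : f ∈ MvPolynomial.vanishingIdeal 𝕜 (variety 𝕜 (k + 1) (n + 1)))
    {g : MvPolynomial (Fin n) (MvPolynomial (Fin n × Fin k) 𝕜)} {N : ℕ}
    (hg : ∀ (t : Fin n → 𝕜) (e : 𝕜) (Y : Matrix (Fin n) (Fin k) 𝕜), e * (1 + t ⬝ᵥ t) = 1 →
        evalPair t Y g * e ^ N = MvPolynomial.aeval (fun p => param t e Y p.1 p.2) f) :
    g * denom 𝕜 n k ∈ (MvPolynomial.vanishingIdeal 𝕜 (variety 𝕜 k n)).map MvPolynomial.C := by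
  rw [mem_map_C_vanishingIdeal_iff]
  intro t Y hY
  rw [map_mul, evalPair_denom]
  -- The factor `denom` handles the t at which the parametrization is undefined.
  by_cases hD : 1 + t ⬝ᵥ t = 0
  · rw [hD, mul_zero]
  have he : (1 + t ⬝ᵥ t)⁻¹ * (1 + t ⬝ᵥ t) = 1 := inv_mul_cancel₀ hD
  have h0 : MvPolynomial.aeval (fun p => param t (1 + t ⬝ᵥ t)⁻¹ Y p.1 p.2) f = 0 :=
    hf _ (param_transpose_mul_self t _ Y he hY)
  rw [← hg t _ Y he] at h0
  rw [(mul_eq_zero.1 h0).resolve_right (pow_ne_zero _ (inv_ne_zero hD)), zero_mul]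

/-- Inverting 1 + Z₀₀ in the quotient by the Stiefel ideal puts the tautological frame in the image
of the parametrization. The pullback of `f` has coefficients in the smaller Stiefel ideal by `ih`,
so `f` dies in the localization. -/
lemma exists_pow_mul_mem_ideal
    (ih : MvPolynomial.vanishingIdeal 𝕜 (variety 𝕜 k n) ≤ ideal 𝕜 k n)
    {f : MvPolynomial (Fin (n + 1) × Fin (k + 1)) 𝕜}
    (hf : f ∈ MvPolynomial.vanishingIdeal 𝕜 (variety 𝕜 (k + 1) (n + 1))) :
    ∃ N : ℕ, (1 + MvPolynomial.X (0, 0)) ^ N * f ∈ ideal 𝕜 (k + 1) (n + 1) := by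
  set I := ideal 𝕜 (k + 1) (n + 1)
  set u : MvPolynomial (Fin (n + 1) × Fin (k + 1)) 𝕜 ⧸ I :=
    Ideal.Quotient.mk I (1 + MvPolynomial.X (0, 0)) with hu
  let B := Localization.Away u
  let φ : MvPolynomial (Fin (n + 1) × Fin (k + 1)) 𝕜 →ₐ[𝕜] B :=
    (IsScalarTower.toAlgHom 𝕜 _ B).comp (Ideal.Quotient.mkₐ 𝕜 I)
  let Z : Matrix (Fin (n + 1)) (Fin (k + 1)) B := (mvPolynomialX (Fin (n + 1)) (Fin (k + 1)) 𝕜).map φ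
  have hZ : Zᵀ * Z = 1 := by
    have := congr_arg (fun M => M.map (algebraMap (MvPolynomial (Fin (n + 1) × Fin (k + 1)) 𝕜 ⧸ I) B))
      (mk_transpose_mul_self (𝕜 := 𝕜) (k := k + 1) (n := n + 1))
    simp only [Matrix.map_mul, transpose_map, Matrix.map_one _ (map_zero _) (map_one _)] at this
    exact this
  have hunit : IsUnit (1 + Z 0 0) := by
    have h : 1 + Z 0 0 = algebraMap _ B u := by
      change 1 + φ (MvPolynomial.X (0, 0)) = φ (1 + MvPolynomial.X (0, 0))
      rw [map_add, map_one]
    exact h ▸ IsLocalization.Away.algebraMap_isUnit (S := B) u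
  obtain ⟨w, hw⟩ := hunit.exists_left_inv
  have h2 : algebraMap 𝕜 B 2⁻¹ * 2 = 1 := by
    rw [← map_ofNat (algebraMap 𝕜 B) 2, ← map_mul, inv_mul_cancel₀ two_ne_zero, map_one]
  obtain ⟨t, Y, he, hY, hZY⟩ := exists_eq_param Z hZ w _ hw h2
  -- The same `g` and `N` serve over 𝕜, where vanishing is known, and over `B`, where it is needed.
  obtain ⟨g, N, hg⟩ := exists_evalPair_eq f
  have hmem := evalPair_mul_denom_eq_zero hf (fun t e Y he => hg t e Y he)
  have hker : (MvPolynomial.vanishingIdeal 𝕜 (variety 𝕜 k n)).map MvPolynomial.C ≤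
      RingHom.ker (evalPair (K := 𝕜) t Y) := by
    rw [Ideal.map_le_iff_le_comap]
    intro q hq
    rw [Ideal.mem_comap, RingHom.mem_ker, evalPair, MvPolynomial.eval₂Hom_C]
    exact aeval_eq_zero_of_mem_ideal Y hY (ih hq)
  have h0 := hker hmem
  rw [RingHom.mem_ker, map_mul, evalPair_denom] at h0
  have hg0 : evalPair t Y g = 0 := by
    linear_combination (algebraMap 𝕜 B 2⁻¹ * (1 + Z 0 0)) * h0 - evalPair t Y g * he
  have hφ : φ f = 0 := by
    have := hg t _ Y he
    rw [hg0, zero_mul, ← hZY] at this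
    rw [this]
    suffices h : φ = MvPolynomial.aeval _ from DFunLike.congr_fun h f
    ext p
    simp [Z]
  have hφ' : algebraMap _ B (Ideal.Quotient.mk I f) = 0 := hφ
  rw [IsLocalization.map_eq_zero_iff (Submonoid.powers u)] at hφ'
  obtain ⟨⟨_, N, rfl⟩, hN⟩ := hφ'
  refine ⟨N, ?_⟩
  rw [← Ideal.Quotient.eq_zero_iff_mem, map_mul, map_pow]
  exact hN

/-- The Stiefel ideal is the vanishing ideal of the Stiefel variety. -/
theorem vanishingIdeal_variety (k n : ℕ) (hkn : k ≤ n) :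
    MvPolynomial.vanishingIdeal 𝕜 (variety 𝕜 k n) = ideal 𝕜 k n := by
  refine le_antisymm ?_ ideal_le_vanishingIdeal
  induction k generalizing n with
  | zero =>
    intro f hf
    have h1 : f = MvPolynomial.C (MvPolynomial.aeval (0 : Fin n × Fin 0 → 𝕜) f) := by
      conv_lhs => rw [MvPolynomial.eq_C_of_isEmpty f]
      congr 1
      conv_rhs => rw [MvPolynomial.eq_C_of_isEmpty f]
      simp
    rw [h1, hf 0 (by rw [mem_variety_iff]; ext a; exact a.elim0), map_zero]
    exact zero_mem _
  | succ k ih =>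
    obtain _ | n := n
    · omega
    have ih := ih n (by omega)
    intro f hf
    obtain ⟨N, hN⟩ := exists_pow_mul_mem_ideal ih hf
    obtain ⟨M, hM⟩ := exists_pow_mul_mem_ideal ih (negHom_mem_vanishingIdeal hf)
    replace hM := negHom_mem_ideal hM
    rw [map_mul, negHom_negHom, map_pow, map_add, map_one] at hM
    have hX : negHom 𝕜 (k + 1) (n + 1) (MvPolynomial.X (0, 0)) = -MvPolynomial.X (0, 0) := by
      simp [negHom]
    rw [hX] at hM
    -- The two elements add up to 2, a unit.
    have hcop : IsCoprime (1 + MvPolynomial.X (0, 0) : MvPolynomial (Fin (n + 1) × Fin (k + 1)) 𝕜)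
        (1 + -MvPolynomial.X (0, 0)) := by
      have h2 : (MvPolynomial.C 2⁻¹ * 2 : MvPolynomial (Fin (n + 1) × Fin (k + 1)) 𝕜) = 1 := by
        rw [← map_ofNat MvPolynomial.C 2, ← map_mul, inv_mul_cancel₀ two_ne_zero, map_one]
      exact ⟨MvPolynomial.C 2⁻¹, MvPolynomial.C 2⁻¹, by linear_combination h2⟩
    obtain ⟨a, b, hab⟩ := hcop.pow (m := N) (n := M)
    have : f = a * ((1 + MvPolynomial.X (0, 0)) ^ N * f) +
        b * ((1 + -MvPolynomial.X (0, 0)) ^ M * f) := by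
      linear_combination (-f) * hab
    rw [this]
    exact add_mem (Ideal.mul_mem_left _ _ hN) (Ideal.mul_mem_left _ _ hM)

end
-- Primality and irreducibility for k < n
section
universe u
variable {𝕜 : Type u} [RCLike 𝕜] {k n : ℕ}

/-- At t = 0 the denominator is 1, and primality provides a frame to evaluate at. -/
lemma denom_notMem (hp : (MvPolynomial.vanishingIdeal 𝕜 (variety 𝕜 k n)).IsPrime) :
    denom 𝕜 n k ∉ (MvPolynomial.vanishingIdeal 𝕜 (variety 𝕜 k n)).map MvPolynomial.C := by
  intro h
  rw [mem_map_C_vanishingIdeal_iff] at h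
  obtain ⟨p, hp⟩ : (variety 𝕜 k n).Nonempty := by
    rw [Set.nonempty_iff_ne_empty]
    intro h
    rw [h, MvPolynomial.vanishingIdeal_empty] at hp
    exact hp.ne_top rfl
  have := h 0 _ hp
  rw [evalPair_denom] at this
  simp at this

/-- If a product vanishes on the frames then one of the factors vanishes where `1 + Z₀₀ ≠ 0`. -/
lemma vanishes_of_mul_mem (hp : (MvPolynomial.vanishingIdeal 𝕜 (variety 𝕜 k n)).IsPrime)
    {f₁ f₂ : MvPolynomial (Fin (n + 1) × Fin (k + 1)) 𝕜}
    (hf : f₁ * f₂ ∈ MvPolynomial.vanishingIdeal 𝕜 (variety 𝕜 (k + 1) (n + 1))) :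
    (∀ p ∈ variety 𝕜 (k + 1) (n + 1), 1 + p (0, 0) ≠ 0 → MvPolynomial.aeval p f₁ = 0) ∨
    (∀ p ∈ variety 𝕜 (k + 1) (n + 1), 1 + p (0, 0) ≠ 0 → MvPolynomial.aeval p f₂ = 0) := by
  obtain ⟨g₁, N₁, hg₁⟩ := exists_evalPair_eq f₁
  obtain ⟨g₂, N₂, hg₂⟩ := exists_evalPair_eq f₂
  have hmem := evalPair_mul_denom_eq_zero (g := g₁ * g₂) (N := N₁ + N₂) hf fun t e Y he => by
    rw [map_mul, map_mul, ← hg₁ t e Y he, ← hg₂ t e Y he]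
    ring
  have hprime : ((MvPolynomial.vanishingIdeal 𝕜 (variety 𝕜 k n)).map
      (MvPolynomial.C (σ := Fin n))).IsPrime := by
    -- The quotient is a polynomial ring in t over a domain.
    rw [← Ideal.Quotient.isDomain_iff_prime]
    exact MulEquiv.isDomain _ (MvPolynomial.quotientEquivQuotientMvPolynomial (σ := Fin n)
      (MvPolynomial.vanishingIdeal 𝕜 (variety 𝕜 k n))).symm.toMulEquiv
  have key : ∀ (f : MvPolynomial (Fin (n + 1) × Fin (k + 1)) 𝕜)
      (g : MvPolynomial (Fin n) (MvPolynomial (Fin n × Fin k) 𝕜)) (N : ℕ)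
      (_ : ∀ (t : Fin n → 𝕜) (e : 𝕜) (Y : Matrix (Fin n) (Fin k) 𝕜), e * (1 + t ⬝ᵥ t) = 1 →
        evalPair t Y g * e ^ N = MvPolynomial.aeval (fun p => param t e Y p.1 p.2) f)
      (_ : g ∈ (MvPolynomial.vanishingIdeal 𝕜 (variety 𝕜 k n)).map MvPolynomial.C),
      ∀ p ∈ variety 𝕜 (k + 1) (n + 1), 1 + p (0, 0) ≠ 0 → MvPolynomial.aeval p f = 0 := by
    intro f g N hg hmem p hp h0
    rw [mem_map_C_vanishingIdeal_iff] at hmem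
    obtain ⟨t, Y, he, hY, hZ⟩ := exists_eq_param (Matrix.of fun i j => p (i, j)) hp _ 2⁻¹
      (inv_mul_cancel₀ h0) (inv_mul_cancel₀ two_ne_zero)
    have := hg t _ Y he
    rw [hmem t Y hY, zero_mul, ← hZ] at this
    exact this.symm
  rcases hprime.mem_or_mem hmem with h | h
  · rcases hprime.mem_or_mem h with h | h
    · exact .inl (key f₁ g₁ N₁ (fun t e Y he => hg₁ t e Y he) h)
    · exact .inr (key f₂ g₂ N₂ (fun t e Y he => hg₂ t e Y he) h)
  · exact absurd h (denom_notMem hp)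

lemma vanishes_of_mul_mem' (hp : (MvPolynomial.vanishingIdeal 𝕜 (variety 𝕜 k n)).IsPrime)
    {f₁ f₂ : MvPolynomial (Fin (n + 1) × Fin (k + 1)) 𝕜}
    (hf : f₁ * f₂ ∈ MvPolynomial.vanishingIdeal 𝕜 (variety 𝕜 (k + 1) (n + 1))) :
    (∀ p ∈ variety 𝕜 (k + 1) (n + 1), 1 - p (0, 0) ≠ 0 → MvPolynomial.aeval p f₁ = 0) ∨
    (∀ p ∈ variety 𝕜 (k + 1) (n + 1), 1 - p (0, 0) ≠ 0 → MvPolynomial.aeval p f₂ = 0) := by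
  have h := negHom_mem_vanishingIdeal hf
  rw [map_mul] at h
  refine (vanishes_of_mul_mem hp h).imp ?_ ?_ <;>
  · intro h p hp hne
    have := h (-p) (neg_mem_variety hp) (by simpa [sub_eq_add_neg] using hne)
    rwa [aeval_negHom, neg_neg] at this

lemma exists_mem_variety_eq_zero (hkn : k < n) :
    ∃ p ∈ variety 𝕜 (k + 1) (n + 1), p (0, 0) = 0 := by
  -- The columns are e₁, …, e_{k+1}; the shift by one fits because k < n.
  refine ⟨fun p => if p.1.val = p.2.val + 1 then 1 else 0, ?_, by simp⟩
  rw [mem_variety_iff]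
  ext a b
  simp only [mul_apply, transpose_apply, of_apply]
  rw [Finset.sum_eq_single ⟨a + 1, by omega⟩]
  · simp [one_apply, Fin.ext_iff]
  · intro c _ hc
    rw [if_neg (fun h => hc (Fin.ext h)), zero_mul]
  · simp

/-- The vanishing ideal of the Stiefel variety is prime for `k < n`. -/
theorem vanishingIdeal_isPrime (k n : ℕ) (hkn : k < n) :
    (MvPolynomial.vanishingIdeal 𝕜 (variety 𝕜 k n)).IsPrime := by
  induction k generalizing n with
  | zero =>
    have : variety 𝕜 0 n = {0} := by
      ext p
      simp only [Set.mem_singleton_iff, mem_variety_iff]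
      exact ⟨fun _ => Subsingleton.elim _ _, fun _ => by ext a; exact a.elim0⟩
    rw [this]
    infer_instance
  | succ k ih =>
    obtain _ | n := n
    · omega
    have ih := ih n (by omega)
    obtain ⟨q, hq, hq0⟩ := exists_mem_variety_eq_zero (𝕜 := 𝕜) (k := k) (n := n) (by omega)
    refine ⟨?_, ?_⟩
    · rw [Ideal.ne_top_iff_one]
      intro h
      simpa using h q hq
    have key : ∀ f₁, (∀ p ∈ variety 𝕜 (k + 1) (n + 1), 1 + p (0, 0) ≠ 0 →
        MvPolynomial.aeval p f₁ = 0) → f₁ ∈ MvPolynomial.vanishingIdeal 𝕜 (variety 𝕜 (k + 1) (n + 1)) := by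
      intro f₁ h
      -- This product vanishes on the whole variety, so the other chart applies to it. Its second
      -- factor is nonzero at `q`, which lies in both charts, so `f₁` vanishes on the other chart
      -- too.
      have hmul : f₁ * (1 + MvPolynomial.X (0, 0)) ∈
          MvPolynomial.vanishingIdeal 𝕜 (variety 𝕜 (k + 1) (n + 1)) := by
        intro p hp
        by_cases h0 : 1 + p (0, 0) = 0
        · simp [h0]
        · rw [map_mul, h p hp h0, zero_mul]
      rcases vanishes_of_mul_mem' ih hmul with h' | h'
      · intro p hp
        by_cases h0 : 1 + p (0, 0) = 0
        · refine h' p hp ?_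
          rw [← neg_eq_of_add_eq_zero_right h0]
          norm_num
        · exact h p hp h0
      · have := h' q hq (by simp [hq0])
        simp [hq0] at this
    intro f₁ f₂ hf
    rcases vanishes_of_mul_mem ih hf with h | h
    · exact .inl (key f₁ h)
    · exact .inr (key f₂ h)

theorem isZariskiIrreducible_variety (hkn : k < n) : IsZariskiIrreducible (variety 𝕜 k n) := by
  have hp := vanishingIdeal_isPrime (𝕜 := 𝕜) k n hkn
  refine ⟨?_, fun I J hIJ => ?_⟩
  · rw [Set.nonempty_iff_ne_empty]
    intro h
    rw [h, MvPolynomial.vanishingIdeal_empty] at hp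
    exact hp.ne_top rfl
  · by_contra! h
    obtain ⟨⟨p, hpV, hpI⟩, ⟨q, hqV, hqJ⟩⟩ := And.imp Set.not_subset.1 Set.not_subset.1 h
    simp only [MvPolynomial.mem_zeroLocus_iff, not_forall] at hpI hqJ
    obtain ⟨f, hf, hfp⟩ := hpI
    obtain ⟨g, hg, hgq⟩ := hqJ
    have : f * g ∈ MvPolynomial.vanishingIdeal 𝕜 (variety 𝕜 k n) := by
      intro x hx
      rw [map_mul]
      rcases hIJ hx with h | h
      · rw [h f hf, zero_mul]
      · rw [h g hg, mul_zero]
    rcases hp.mem_or_mem this with h | h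
    · exact hfp (h p hpV)
    · exact hgq (h q hqV)

end
end Stiefel

/-! ### Height, transcendence degree and Krull dimension -/

section HeightTrdeg
universe v
open Polynomial

/-- If `d ≤ ht q + trdeg (A / q)` for all primes `q` of `A` then the same holds for `A[X]` and
`d + 1`. -/
lemma Polynomial.le_height_add_trdeg {K A : Type*} [Field K] [CommRing A] [IsNoetherianRing A]
    [Algebra K A] {d : ℕ∞}
    (h : ∀ q : Ideal A, q.IsPrime → d ≤ q.height + Cardinal.toENat (Algebra.trdeg K (A ⧸ q)))
    (p : Ideal A[X]) [hp : p.IsPrime] :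
    d + 1 ≤ p.height + Cardinal.toENat (Algebra.trdeg K (A[X] ⧸ p)) := by
  set q : Ideal A := p.under A with hq
  have hqp : q.IsPrime := inferInstance
  have : p.LiesOver q := ⟨rfl⟩
  rw [Ideal.height_eq_height_add_of_liesOver_of_hasGoingDown q p]
  have hle : q.map (algebraMap A A[X]) ≤ p := Ideal.map_le_iff_le_comap.2 le_rfl
  have hd : (q.map (algebraMap A A[X])).IsPrime := Ideal.isPrime_map_C_of_isPrime
  -- If `p` is extended from `q`, the extra 1 comes from the transcendence degree of (A/q)[X];
  -- otherwise it comes from the height, `p` being strictly larger than the extension.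
  by_cases hpq : q.map (algebraMap A A[X]) = p
  · have e : (A ⧸ q)[X] ≃ₐ[K] A[X] ⧸ p := by
      rw [← hpq]
      refine AlgEquiv.ofRingEquiv (f := Ideal.polynomialQuotientEquivQuotientPolynomial q) fun r => ?_
      have := Ideal.polynomialQuotientEquivQuotientPolynomial_map_mk q (C (algebraMap K A r))
      rw [Polynomial.map_C] at this
      exact this
    have h1 : Algebra.trdeg K (A ⧸ q) + 1 ≤ Algebra.trdeg K (A[X] ⧸ p) := by
      rw [← e.trdeg_eq, ← Polynomial.trdeg_of_isDomain (R := A ⧸ q)]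
      exact _root_.trdeg_add_le
    calc d + 1 ≤ q.height + Cardinal.toENat (Algebra.trdeg K (A ⧸ q)) + 1 := by
          gcongr; exact h q hqp
      _ = q.height + Cardinal.toENat (Algebra.trdeg K (A ⧸ q) + 1) := by
          rw [map_add, map_one, add_assoc]
      _ ≤ _ := by
          gcongr
          exact le_self_add
  · have h1 : 1 ≤ (p.map (Ideal.Quotient.mk (q.map (algebraMap A A[X])))).height := by
      have := Ideal.isPrime_map_quotientMk_of_isPrime hle
      rw [Order.one_le_iff_ne_zero, Ne, Ideal.height_eq_zero_iff_eq_bot,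
        Ideal.map_eq_bot_iff_le_ker, Ideal.mk_ker]
      exact fun h => hpq (le_antisymm hle h)
    have h2 : Algebra.trdeg K (A ⧸ q) ≤ Algebra.trdeg K (A[X] ⧸ p) := by
      refine _root_.trdeg_le_of_injective
        (Ideal.quotientMapₐ p (IsScalarTower.toAlgHom K A A[X]) le_rfl) ?_
      exact Ideal.quotientMap_injective
    calc d + 1 ≤ q.height + Cardinal.toENat (Algebra.trdeg K (A ⧸ q)) + 1 := by
          gcongr; exact h q hqp
      _ = q.height + 1 + Cardinal.toENat (Algebra.trdeg K (A ⧸ q)) := by ring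
      _ ≤ _ := by gcongr

lemma AlgEquiv.le_height_add_trdeg {K : Type*} {A B : Type v} [Field K] [CommRing A] [CommRing B]
    [Algebra K A] [Algebra K B] (e : A ≃ₐ[K] B) {d : ℕ∞}
    (h : ∀ q : Ideal A, q.IsPrime → d ≤ q.height + Cardinal.toENat (Algebra.trdeg K (A ⧸ q)))
    (p : Ideal B) [hp : p.IsPrime] :
    d ≤ p.height + Cardinal.toENat (Algebra.trdeg K (B ⧸ p)) := by
  have h1 := h (p.comap e.toRingEquiv) inferInstance
  rw [RingEquiv.height_comap] at h1
  have e' : (A ⧸ p.comap e.toRingEquiv) ≃ₐ[K] B ⧸ p :=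
    Ideal.quotientEquivAlg _ _ e (Ideal.map_comap_of_surjective _ e.surjective p).symm
  rwa [e'.trdeg_eq] at h1

/-- The height of a prime of a polynomial ring over a field and the transcendence degree of the
quotient add up to at least the number of variables. -/
lemma MvPolynomial.le_height_add_trdeg {K : Type*} {σ : Type*} [Field K] [Finite σ]
    (p : Ideal (MvPolynomial σ K)) [hp : p.IsPrime] :
    (Nat.card σ : ℕ∞) ≤ p.height + Cardinal.toENat (Algebra.trdeg K (MvPolynomial σ K ⧸ p)) := by
  revert p
  induction σ using Finite.induction_empty_option with
  | of_equiv e ih =>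
    rw [← Nat.card_congr e]
    exact (MvPolynomial.renameEquiv K e).le_height_add_trdeg ih
  | h_empty => simp
  | @h_option σ _ ih =>
    have h : (Nat.card (Option σ) : ℕ∞) = Nat.card σ + 1 := by
      rw [Finite.card_option]; push_cast; rfl
    rw [h]
    exact (MvPolynomial.optionEquivLeft K σ).symm.le_height_add_trdeg
      fun q _ => Polynomial.le_height_add_trdeg ih q

lemma LTSeries.height_head_add_length_le {R : Type*} [CommRing R] (l : LTSeries (PrimeSpectrum R)) :
    l.head.asIdeal.height + l.length ≤ l.last.asIdeal.height := by
  have key : ∀ i (hi : i < l.length + 1), l.head.asIdeal.height + i ≤ (l ⟨i, hi⟩).asIdeal.height := by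
    intro i
    induction i with
    | zero => intro _; simp [RelSeries.head]
    | succ i ih =>
      intro hi
      refine le_trans ?_ (Ideal.height_add_one_le_of_lt_of_isPrime
        (l.step ⟨i, by omega⟩ : (l ⟨i, by omega⟩).asIdeal < _))
      push_cast
      rw [← add_assoc]
      gcongr
      exact ih _
  exact key l.length (by omega)

/-- A chain of primes above I starts at a prime of height at least that of I, and each strict step
raises the height by at least one. -/
lemma ringKrullDim_quotient_add_height_le {R : Type*} [CommRing R] (I : Ideal R) (hI : I ≠ ⊤) :
    ringKrullDim (R ⧸ I) + I.height ≤ ringKrullDim R := by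
  have : Nonempty (PrimeSpectrum.zeroLocus (R := R) I) := by
    rwa [Set.nonempty_coe_sort, Set.nonempty_iff_ne_empty, ne_eq,
      PrimeSpectrum.zeroLocus_empty_iff_eq_top]
  have := Ideal.Quotient.nontrivial_iff.2 hI
  have := (Ideal.Quotient.mk I).domain_nontrivial
  obtain ⟨d, hd⟩ := WithBot.ne_bot_iff_exists.1
    (Order.bot_lt_krullDim (α := PrimeSpectrum R)).ne'
  rw [ringKrullDim_quotient, Order.krullDim_eq_iSup_length, ← WithBot.coe_add, ENat.iSup_add, ringKrullDim, ← hd,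
    WithBot.coe_le_coe]
  refine iSup_le fun l => ?_
  have h1 := (l.map Subtype.val fun _ _ => id).height_head_add_length_le
  have h2 : I.height ≤ (l.map Subtype.val fun _ _ => id).head.asIdeal.height :=
    Ideal.height_mono l.head.2
  have h3 := Ideal.height_le_ringKrullDim_of_isPrime
    (I := (l.map Subtype.val fun _ _ => id : LTSeries (PrimeSpectrum R)).last.asIdeal)
  rw [ringKrullDim, ← hd, WithBot.coe_le_coe] at h3
  rw [add_comm]
  exact (add_le_add_left h2 _).trans (h1.trans h3)

end HeightTrdeg

/-! ### Height of the Stiefel ideal and complete intersection -/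

namespace Stiefel

/-- The entries of an orthonormal frame over a field are rational functions in `nk - (k + 1) choose 2`
elements. -/
lemma exists_finset_adjoin (K : Type*) {L : Type*} [Field K] [Field L] [Algebra K L] (h2 : (2 : L) ≠ 0)
    (k n : ℕ) (hkn : k ≤ n) (Z : Matrix (Fin n) (Fin k) L) (hZ : Zᵀ * Z = 1) :
    ∃ S : Finset L, S.card + (k + 1).choose 2 ≤ n * k ∧
      ∀ i j, Z i j ∈ IntermediateField.adjoin K (S : Set L) := by
  classical
  induction k generalizing n with
  | zero => exact ⟨∅, by simp, fun _ j => j.elim0⟩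
  | succ k ih =>
    obtain _ | n := n
    · omega
    -- If this fails for both Z and -Z, then 2 = 0.
    wlog h0 : 1 + Z 0 0 ≠ 0 generalizing Z
    · obtain ⟨S, hS, h⟩ := this (-Z) (neg_transpose_mul_self hZ) fun h => h2 (by
        rw [Matrix.neg_apply] at h
        linear_combination h + not_not.1 h0)
      exact ⟨S, hS, fun i j => by simpa using neg_mem (h i j)⟩
    obtain ⟨t, Y, he, hY, hZY⟩ := exists_eq_param Z hZ _ 2⁻¹ (inv_mul_cancel₀ h0) (inv_mul_cancel₀ h2)
    obtain ⟨S, hS, hmem⟩ := ih n (by omega) Y hY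
    refine ⟨S ∪ Finset.univ.image t, ?_, fun i j => ?_⟩
    · have h1 := Finset.card_union_le S (Finset.univ.image t)
      have h2 := Finset.card_image_le (s := Finset.univ) (f := t)
      rw [Finset.card_univ, Fintype.card_fin] at h2
      -- The n coordinates of t are added, and (n + 1)(k + 1) = nk + n + (k + 1).
      have h3 : (k + 1 + 1).choose 2 = (k + 1) + (k + 1).choose 2 := by
        rw [Nat.choose_succ_succ' (k + 1) 1, Nat.choose_one_right]
      rw [h3]
      nlinarith
    · set E := IntermediateField.adjoin K ((S ∪ Finset.univ.image t : Finset L) : Set L)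
      have ht : ∀ i, t i ∈ E := fun i => IntermediateField.subset_adjoin _ _ (by simp)
      have hYE : ∀ i j, Y i j ∈ E := fun i j =>
        IntermediateField.adjoin.mono _ _ _ (by simp) (hmem i j)
      have heE : 2⁻¹ * (1 + Z 0 0) ∈ E := by
        rw [eq_inv_of_mul_eq_one_left he]
        exact inv_mem (add_mem (one_mem _) (sum_mem fun i _ => mul_mem (ht i) (ht i)))
      have := congr_fun (congr_fun (param_map (E.val : E →+* L) (fun i => ⟨t i, ht i⟩) ⟨_, heE⟩
        (Matrix.of fun i j => ⟨Y i j, hYE i j⟩)) i) j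
      rw [hZY]
      refine Set.mem_of_eq_of_mem this.symm (Subtype.prop _)

section
variable {𝕜 : Type*} [RCLike 𝕜] {k n : ℕ}

lemma trdeg_quotient_le {p : Ideal (MvPolynomial (Fin n × Fin k) 𝕜)} [p.IsPrime] (hkn : k ≤ n)
    (hp : ideal 𝕜 k n ≤ p) : ∃ d : ℕ, d + (k + 1).choose 2 ≤ n * k ∧
      Algebra.trdeg 𝕜 (MvPolynomial (Fin n × Fin k) 𝕜 ⧸ p) ≤ d := by
  set A := MvPolynomial (Fin n × Fin k) 𝕜 ⧸ p
  let L := FractionRing A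
  let φ : MvPolynomial (Fin n × Fin k) 𝕜 →ₐ[𝕜] L :=
    (IsScalarTower.toAlgHom 𝕜 A L).comp (Ideal.Quotient.mkₐ 𝕜 p)
  have hZ : ((mvPolynomialX (Fin n) (Fin k) 𝕜).map φ)ᵀ * (mvPolynomialX (Fin n) (Fin k) 𝕜).map φ =
      1 := by
    have := congr_arg (fun M => M.map ((algebraMap A L).comp (Ideal.Quotient.factor hp)))
      (mk_transpose_mul_self (𝕜 := 𝕜) (k := k) (n := n))
    simp only [Matrix.map_mul, transpose_map, Matrix.map_one _ (map_zero _) (map_one _)] at this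
    exact this
  have h2 : (2 : L) ≠ 0 := by
    rw [← map_ofNat (algebraMap 𝕜 L) 2]
    exact (map_ne_zero _).2 two_ne_zero
  obtain ⟨S, hS, hmem⟩ := exists_finset_adjoin 𝕜 h2 k n hkn _ hZ
  refine ⟨S.card, hS, ?_⟩
  have hφ (f) : φ f ∈ IntermediateField.adjoin 𝕜 (S : Set L) := by
    induction f using MvPolynomial.induction_on with
    | C a => exact (φ.commutes a).symm ▸ IntermediateField.algebraMap_mem _ a
    | add f g hf hg => exact map_add φ f g ▸ add_mem hf hg
    | mul_X f p hf => exact map_mul φ f _ ▸ mul_mem hf (hmem p.1 p.2)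
  -- `L` is the field generated by `S`, so every element is a quotient of elements of the algebra
  -- generated by `S`.
  have halg : Algebra.IsAlgebraic (Algebra.adjoin 𝕜 (S : Set L)) L := by
    refine ⟨fun x => ?_⟩
    have hx : x ∈ IntermediateField.adjoin 𝕜 (S : Set L) := by
      obtain ⟨a, b, -, rfl⟩ := IsFractionRing.div_surjective (A := A) x
      obtain ⟨a, rfl⟩ := Ideal.Quotient.mk_surjective a
      obtain ⟨b, rfl⟩ := Ideal.Quotient.mk_surjective b
      exact div_mem (hφ a) (hφ b)
    obtain ⟨r, hr, s, hs, rfl⟩ := IntermediateField.mem_adjoin_iff_div.1 hx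
    rw [div_eq_mul_inv]
    exact (isAlgebraic_algebraMap (⟨r, hr⟩ : Algebra.adjoin 𝕜 (S : Set L))).mul
      (isAlgebraic_algebraMap (⟨s, hs⟩ : Algebra.adjoin 𝕜 (S : Set L))).inv
  calc Algebra.trdeg 𝕜 A ≤ Algebra.trdeg 𝕜 L :=
        trdeg_le_of_injective (IsScalarTower.toAlgHom 𝕜 A L) (IsFractionRing.injective A L)
    _ ≤ Cardinal.mk (S : Set L) := Algebra.IsAlgebraic.trdeg_le_cardinalMk 𝕜 _
    _ = S.card := Cardinal.mk_coe_finset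

/-- At each minimal prime, height plus transcendence degree is at least nk; cancel the finite bound
on the latter. -/
lemma le_height_ideal (hkn : k ≤ n) : ((k + 1).choose 2 : ℕ∞) ≤ (ideal 𝕜 k n).height := by
  rw [Ideal.height_eq_inf_minimalPrimes]
  refine le_iInf₂ fun p hp => ?_
  have := hp.1.1
  obtain ⟨d, hd, htr⟩ := trdeg_quotient_le hkn hp.1.2
  have h := MvPolynomial.le_height_add_trdeg p
  have h' : Cardinal.toENat (Algebra.trdeg 𝕜 (MvPolynomial (Fin n × Fin k) 𝕜 ⧸ p)) ≤ d := by
    simpa using Cardinal.toENat.monotone' htr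
  rw [Nat.card_prod, Nat.card_fin, Nat.card_fin] at h
  have h3 : ((d + (k + 1).choose 2 : ℕ) : ℕ∞) ≤ p.height + d :=
    (Nat.cast_le.2 hd).trans (h.trans (by gcongr))
  rw [Nat.cast_add, add_comm] at h3
  exact (ENat.add_le_add_iff_right (ENat.natCast_ne_top d)).1 h3

/-- The upper triangular generators of the Stiefel ideal. -/
lemma exists_span_range_eq (𝕜 : Type*) [RCLike 𝕜] (k n : ℕ) :
    ∃ f : Fin ((k + 1).choose 2) → MvPolynomial (Fin n × Fin k) 𝕜,
      Ideal.span (Set.range f) = ideal 𝕜 k n := by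
  set M : Matrix (Fin k) (Fin k) (MvPolynomial (Fin n × Fin k) 𝕜) :=
    (mvPolynomialX (Fin n) (Fin k) 𝕜)ᵀ * mvPolynomialX (Fin n) (Fin k) 𝕜 - 1 with hM
  have hsymm : ∀ a b, M a b = M b a := fun a b => by
    have : Mᵀ = M := by simp [hM]
    exact congr_fun (congr_fun this b) a
  -- Symmetry leaves one generator for each unordered pair of columns, repetition allowed.
  let e : Fin ((k + 1).choose 2) ≃ Sym2 (Fin k) :=
    (Fintype.equivFinOfCardEq (by rw [Sym2.card, Fintype.card_fin])).symm
  refine ⟨fun i => Sym2.lift ⟨fun a b => M a b, hsymm⟩ (e i), ?_⟩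
  rw [ideal, ← hM]
  congr 1
  ext x
  constructor
  · rintro ⟨i, rfl⟩
    induction h : e i using Sym2.ind with
    | _ a b => exact ⟨(a, b), by simp [h]⟩
  · rintro ⟨⟨a, b⟩, rfl⟩
    exact ⟨e.symm s(a, b), by simp⟩

lemma variety_nonempty (hkn : k ≤ n) : (variety 𝕜 k n).Nonempty := by
  refine ⟨fun p => if p.1.val = p.2.val then 1 else 0, ?_⟩
  rw [mem_variety_iff]
  ext a b
  simp only [mul_apply, transpose_apply, of_apply]
  rw [Finset.sum_eq_single ⟨a, by omega⟩]
  · simp [one_apply, Fin.ext_iff]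
  · intro c _ hc
    rw [if_neg (fun h => hc (Fin.ext h)), zero_mul]
  · simp

lemma ideal_ne_top (hkn : k ≤ n) : ideal 𝕜 k n ≠ ⊤ := by
  obtain ⟨p, hp⟩ := variety_nonempty (𝕜 := 𝕜) hkn
  rw [Ideal.ne_top_iff_one]
  intro h
  simpa using ideal_le_vanishingIdeal h p hp

lemma spanFinrank_ideal_le : (ideal 𝕜 k n).spanFinrank ≤ (k + 1).choose 2 := by
  obtain ⟨f, hf⟩ := exists_span_range_eq 𝕜 k n
  rw [← hf]
  refine (Submodule.spanFinrank_span_le_ncard_of_finite (Set.finite_range f)).trans ?_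
  rw [← Set.image_univ]
  exact (Set.ncard_image_le Set.finite_univ).trans (by simp [Set.ncard_univ])

lemma height_ideal (hkn : k ≤ n) : (ideal 𝕜 k n).height = (k + 1).choose 2 :=
  le_antisymm ((Ideal.height_le_spanFinrank _ (ideal_ne_top hkn)).trans
    (Nat.cast_le.2 spanFinrank_ideal_le)) (le_height_ideal hkn)

theorem isCompleteIntersection_ideal (hkn : k ≤ n) : IsCompleteIntersection (ideal 𝕜 k n) := by
  obtain ⟨f, hf⟩ := exists_span_range_eq 𝕜 k n
  exact ⟨ideal_ne_top hkn, _, f, hf, height_ideal hkn⟩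

/-! ### Dimension of the variety -/

/-- The maximal ideal of a rational point of affine space has full height. -/
lemma le_height_ker_aeval {K σ : Type*} [Field K] [Finite σ] (x : σ → K) :
    (Nat.card σ : ℕ∞) ≤ (RingHom.ker (MvPolynomial.aeval (R := K) x)).height := by
  have := RingHom.ker_isPrime (MvPolynomial.aeval (R := K) x)
  have h := MvPolynomial.le_height_add_trdeg (RingHom.ker (MvPolynomial.aeval (R := K) x))
  have hsurj : Function.Surjective (MvPolynomial.aeval (R := K) x) := fun a =>
    ⟨MvPolynomial.C a, by simp⟩
  have h0 := (Ideal.quotientKerAlgEquivOfSurjective hsurj).lift_trdeg_eq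
  rw [trdeg_eq_zero (R := K) (A := K), Cardinal.lift_zero, Cardinal.lift_eq_zero] at h0
  rwa [h0, map_zero, add_zero] at h

/-- The upper bound uses the height. For the lower bound, the maximal ideal of a point of the
variety has height at least nk, and passing to the quotient loses at most the number of generators.
-/
lemma ringKrullDim_quotient_ideal (hkn : k ≤ n) :
    ringKrullDim (MvPolynomial (Fin n × Fin k) 𝕜 ⧸ ideal 𝕜 k n) + (k + 1).choose 2 =
      (n * k : ℕ) := by
  refine le_antisymm ?_ ?_
  · have h := ringKrullDim_quotient_add_height_le _ (ideal_ne_top (𝕜 := 𝕜) hkn)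
    rw [height_ideal hkn, MvPolynomial.ringKrullDim_of_isNoetherianRing,
      ringKrullDim_eq_zero_of_field, zero_add, Nat.card_prod, Nat.card_fin, Nat.card_fin] at h
    exact h
  · obtain ⟨p, hp⟩ := variety_nonempty (𝕜 := 𝕜) hkn
    have hle : ideal 𝕜 k n ≤ RingHom.ker (MvPolynomial.aeval (R := 𝕜) p) := fun f hf =>
      ideal_le_vanishingIdeal hf p hp
    have := RingHom.ker_isPrime (MvPolynomial.aeval (R := 𝕜) p)
    have h1 := le_height_ker_aeval p
    rw [Nat.card_prod, Nat.card_fin, Nat.card_fin] at h1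
    calc ((n * k : ℕ) : WithBot ℕ∞) ≤ (RingHom.ker (MvPolynomial.aeval (R := 𝕜) p)).height := by
          exact_mod_cast h1
      _ ≤ _ := height_le_ringKrullDim_quotient_add_spanFinrank hle
      _ ≤ _ := by
          gcongr
          exact_mod_cast spanFinrank_ideal_le

lemma choose_two_add_mul (hkn : k ≤ n) :
    n.choose 2 + (k + 1).choose 2 = n * k + (n - k).choose 2 := by
  obtain ⟨m, rfl⟩ := Nat.exists_eq_add_of_le hkn
  rw [Nat.add_sub_cancel_left]
  induction k with
  | zero => simp
  | succ k ih =>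
    have ih := ih (by omega)
    have h1 : (k + 1 + m).choose 2 = (k + m) + (k + m).choose 2 := by
      rw [show k + 1 + m = k + m + 1 by ring, Nat.choose_succ_succ' (k + m) 1, Nat.choose_one_right]
    have h2 : (k + 1 + 1).choose 2 = (k + 1) + (k + 1).choose 2 := by
      rw [Nat.choose_succ_succ' (k + 1) 1, Nat.choose_one_right]
    rw [h1, h2]
    nlinarith

/-- The second conjunct certifies that the natural subtraction is not truncated. -/
theorem affineDim_variety (hkn : k ≤ n) :
    affineDim (variety 𝕜 k n) = (n * k - (k + 1).choose 2 : ℕ) ∧ (k + 1).choose 2 ≤ n * k := by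
  have h := ringKrullDim_quotient_ideal (𝕜 := 𝕜) hkn
  rw [affineDim, vanishingIdeal_variety k n hkn]
  generalize ringKrullDim (MvPolynomial (Fin n × Fin k) 𝕜 ⧸ ideal 𝕜 k n) = d at h ⊢
  induction d using WithBot.recBotCoe with
  | bot => rw [WithBot.bot_add] at h; exact absurd h.symm (WithBot.natCast_ne_bot _)
  | coe d =>
    have h' : d + ((k + 1).choose 2 : ℕ) = ((n * k : ℕ) : ℕ∞) := by exact_mod_cast h
    induction d using ENat.recTopCoe with
    | top => rw [top_add] at h'; exact absurd h'.symm (ENat.natCast_ne_top _)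
    | coe d =>
      have h'' : d + (k + 1).choose 2 = n * k := by exact_mod_cast h'
      rw [← h'', Nat.add_sub_cancel]
      exact ⟨rfl, Nat.le_add_left _ _⟩

end
end Stiefel

end

theorem theorem2p3 (𝕜 : Type*) [RCLike 𝕜] (k n : ℕ) (hkn : k ≤ n) :
    (∃ d : ℕ, affineDim (Stiefel.variety 𝕜 k n) = d ∧
      (d : ℤ) = n * k - (k + 1).choose 2 ∧
      (d : ℤ) = n.choose 2 - (n - k).choose 2) ∧
    MvPolynomial.vanishingIdeal 𝕜 (Stiefel.variety 𝕜 k n) = Stiefel.ideal 𝕜 k n ∧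
    IsCompleteIntersection (Stiefel.ideal 𝕜 k n) ∧
    (k < n →
      IsZariskiIrreducible (Stiefel.variety 𝕜 k n) ∧ (Stiefel.ideal 𝕜 k n).IsPrime) := by
  obtain ⟨hdim, hle⟩ := Stiefel.affineDim_variety (𝕜 := 𝕜) hkn
  have hchoose := Stiefel.choose_two_add_mul hkn
  refine ⟨⟨_, hdim, by push_cast [hle]; ring, ?_⟩, Stiefel.vanishingIdeal_variety k n hkn,
    Stiefel.isCompleteIntersection_ideal hkn, fun hlt => ⟨Stiefel.isZariskiIrreducible_variety hlt, ?_⟩⟩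
  · zify at hchoose
    push_cast [hle]
    linarith
  · rw [← Stiefel.vanishingIdeal_variety k n hkn]
    exact Stiefel.vanishingIdeal_isPrime k n hlt
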